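/- **Setting.** For $x\in\mathbb R^n$ let $\operatorname{supp}x=\{i:x_i\ne0\}$; $x$ is $k$-sparse if $|\operatorname{supp}x|\le k$. Write $\hat x=x/\|x\|_2$ for $x\neq 0$ and $\hat 0=0$. For $A\in\mathbb R^{m\times n}$ let $\operatorname{sign}(Ax)\in\{-1,0,1\}^m$ be the entrywise sign, with $\operatorname{sign}(0)=0$. A $0/1$ matrix is *$(k,l)$-list disjunct* if for all disjoint sets $S,T$ of column indices with $|S|=k$, $|T|=l$, some row has a nonzero entry in a column of $T$ and only zeros in the columns of $S$. Let $X$ be a set of signals in $\mathbb R^n$. * $A$ *can be used for $\epsilon$-approximate recovery of $X$* if there is a decoder $f:\{-1,0,1\}^m\to\mathbb R^n$ such that $f(\operatorname{sign}(Ax))\ne0$ and $\big\|\hat x-\tfrac{f(\operatorname{sign}(Ax))}{\|f(\operatorname{sign}(Ax))\|_2}\big\|_2\le\epsilon$ for all nonzero $x\in X$. * $A$ *separates $X$ at $\epsilon$* if $\operatorname{sign}(Ax)\ne\operatorname{sign}(Ay)$ for all nonzero $x,y\in X$ with $\|\hat x-\hat y\|_2>\epsilon$. * $A$ *can be used for exact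 recovery of $X$* if there is $g:\{-1,0,1\}^m\to\mathbb R^n$ with $g(\operatorname{sign}(Ax))=\hat x$ for all $x\in X$ (sign measurements never reveal the norm). For $k\ge1$ let $B_{n,k}$ be the set of all $k$-sparse $x\in\mathbb R^n$ whose nonzero entries are all equal. **Statement.** 1. If $x,y\in B_{n,k}$ and $\hat x\ne\hat y$, then $\|\hat x-\hat y\|_2\ge1/\sqrt k$. 2. Let $M=\begin{bmatrix}M^{(1)}\\M^{(2)}\end{bmatrix}$ have $n$ columns, where $M^{(1)}$ is $(k,l)$-list disjunct, and suppose that, for some real $\epsilon$, one of the following holds: (a) $\epsilon<1/\sqrt k$, and for every $U\subseteq[n]$ with $|U|\le k+l$ the matrix $M^{(2)}$ separates the $k$-sparse vectors supported in $U$ at $\epsilon$; (b) $\epsilon<1/(2\sqrt k)$, and for every $U\subseteq[n]$ with $|U|\le k+l$ the matrix $M^{(2)}$ can be used for $\epsilon$-approximate recovery of the $k$-sparse vectors supported in $U$. Then $M$ can be used for exact recovery of $B_{n,k}$. 3. For every constant $c\in(0,1)$ there is a constant $C>0$, depending only on $c$, such that for all $n\ge2$ and $1\le k\le n$ there are an integer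 $l\le Ck$, a $(k,l)$-list disjunct matrix $M^{(1)}$ with at most $Ck\log\frac nk$ rows, and a matrix $M^{(2)}$ with at most $Ck^{3/2}\log\frac{n^{3/2}}{\sqrt k}$ rows that separates the set of all $k$-sparse vectors in $\mathbb R^n$ at $\epsilon=c/\sqrt k$ and can be used for $\epsilon$-approximate recovery of this set, such that $M=\begin{bmatrix}M^{(1)}\\M^{(2)}\end{bmatrix}$, which has at most $C\big(k\log\frac nk+k^{3/2}\log\frac{n^{3/2}}{\sqrt k}\big)$ rows, can be used for exact recovery of $B_{n,k}$. -/

import Mathlib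

/-- The support of a vector: the set of indices of its nonzero entries. -/
noncomputable def vecSupp {n : ℕ} (x : EuclideanSpace ℝ (Fin n)) : Finset (Fin n) :=
  Finset.univ.filter fun i => x i ≠ 0

/-- The one-bit measurements `sign (A x)`, one value in `{-1, 0, 1}` for each row of `A`. -/
noncomputable def signMeas {ι : Type} {n : ℕ} (A : Matrix ι (Fin n) ℝ)
    (x : EuclideanSpace ℝ (Fin n)) : ι → SignType :=
  fun i => SignType.sign (A.mulVec x.ofLp i)

/-- The normalized signal `x / ‖x‖₂` (equal to `0` for `x = 0`). -/
noncomputable def direction {n : ℕ} (x : EuclideanSpace ℝ (Fin n)) : EuclideanSpace ℝ (Fin n) :=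
  ‖x‖⁻¹ • x

/-- The `k`-sparse signals that vanish outside `U`. -/
def sparseWithin {n : ℕ} (k : ℕ) (U : Finset (Fin n)) : Set (EuclideanSpace ℝ (Fin n)) :=
  {x | (vecSupp x).card ≤ k ∧ vecSupp x ⊆ U}

/-- The `k`-sparse signals all of whose nonzero entries are equal (rescaled binary vectors). -/
def scaledBinary (n k : ℕ) : Set (EuclideanSpace ℝ (Fin n)) :=
  {x | (vecSupp x).card ≤ k ∧ ∀ i j, x i ≠ 0 → x j ≠ 0 → x i = x j}

/-- A binary matrix is `(k, l)`-list disjunct if for any disjoint sets `S`, `T` of `k` and `l`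
columns some row has a nonzero entry in a column of `T` and only zeros in the columns of `S`. -/
def IsListDisjunct {ι : Type} {n : ℕ} (M : Matrix ι (Fin n) ℝ) (k l : ℕ) : Prop :=
  (∀ i j, M i j = 0 ∨ M i j = 1) ∧
    ∀ S T : Finset (Fin n), Disjoint S T → S.card = k → T.card = l →
      ∃ i, (∃ j ∈ T, M i j ≠ 0) ∧ ∀ j ∈ S, M i j = 0

/-- `A` can be used for `ε`-approximate recovery of the nonzero signals in `X`: some decoder maps
the sign measurements of each of them to a nonzero vector of almost the same direction. -/
def CanApproxRecover {ι : Type} {n : ℕ} (A : Matrix ι (Fin n) ℝ) (ε : ℝ)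
    (X : Set (EuclideanSpace ℝ (Fin n))) : Prop :=
  ∃ f : (ι → SignType) → EuclideanSpace ℝ (Fin n), ∀ x ∈ X, x ≠ 0 →
    f (signMeas A x) ≠ 0 ∧ ‖direction x - direction (f (signMeas A x))‖ ≤ ε

/-- Nonzero signals in `X` whose directions are more than `ε` apart have different sign
measurements; equivalently, every nonzero signal in `X` that is consistent with the measurements
of `x` approximates `x` up to `ε`. -/
def SeparatesAt {ι : Type} {n : ℕ} (A : Matrix ι (Fin n) ℝ) (ε : ℝ)
    (X : Set (EuclideanSpace ℝ (Fin n))) : Prop :=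
  ∀ x ∈ X, ∀ y ∈ X, x ≠ 0 → y ≠ 0 → ε < ‖direction x - direction y‖ →
    signMeas A x ≠ signMeas A y

/-- `A` can be used for exact recovery of the signals in `X`, up to the positive scaling factor,
which sign measurements never reveal. -/
def CanExactlyRecover {ι : Type} {n : ℕ} (A : Matrix ι (Fin n) ℝ)
    (X : Set (EuclideanSpace ℝ (Fin n))) : Prop :=
  ∃ g : (ι → SignType) → EuclideanSpace ℝ (Fin n), ∀ x ∈ X, g (signMeas A x) = direction x

/-! ### Exact recovery from the two-part matrix -/

section Recovery

variable {ι : Type} {n : ℕ}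

/-! Exact recovery amounts to injectivity: equal measurements must force equal directions. On a
rescaled binary vector a 0/1 row cannot cancel, so it measures zero exactly when it misses the
support. List disjunctness then leaves at most `k + l` columns that no zero measurement rules out,
and two signals with the same measurements both live there (`IsListDisjunct.exists_common_support`).
Distinct directions are at least `1 / √k` apart, so the second block tells them apart.

Existence is probabilistic: if each of `P` events has probability at least `δ`, about `log P / δ`
points hit them all (`exists_points_hit_all`). For list disjunctness, a random 0/1 row serves a
fixed pair of `k`-sets with probability `1 / 4`. For separation, a Gaussian row splits a fixed pair
of unit vectors more than `ε` apart with probability of order `ε`, and with a margin, so a net with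
`log P` of order `k log n` suffices. With `ε = c / √k` this costs order `k^(3/2) log n` rows. -/

lemma mem_vecSupp {x : EuclideanSpace ℝ (Fin n)} {i : Fin n} : i ∈ vecSupp x ↔ x i ≠ 0 := by
  simp [vecSupp]

lemma direction_apply (x : EuclideanSpace ℝ (Fin n)) (i : Fin n) :
    direction x i = ‖x‖⁻¹ * x i := rfl

lemma direction_zero : direction (0 : EuclideanSpace ℝ (Fin n)) = 0 := by
  simp [direction]

lemma norm_direction {x : EuclideanSpace ℝ (Fin n)} (hx : x ≠ 0) : ‖direction x‖ = 1 := by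
  rw [direction, norm_smul, norm_inv, norm_norm, inv_mul_cancel₀ (norm_ne_zero_iff.2 hx)]

lemma direction_neg (x : EuclideanSpace ℝ (Fin n)) : direction (-x) = -direction x := by
  simp [direction]

lemma vecSupp_direction (x : EuclideanSpace ℝ (Fin n)) : vecSupp (direction x) = vecSupp x := by
  ext i
  rw [mem_vecSupp, mem_vecSupp, direction_apply, mul_ne_zero_iff]
  refine ⟨fun h => h.2, fun h => ⟨?_, h⟩⟩
  rintro h0
  rw [inv_eq_zero, norm_eq_zero] at h0
  simp [h0] at h

lemma vecSupp_neg (x : EuclideanSpace ℝ (Fin n)) : vecSupp (-x) = vecSupp x := by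
  ext i; simp [mem_vecSupp]

lemma signMeas_direction (A : Matrix ι (Fin n) ℝ) (x : EuclideanSpace ℝ (Fin n)) :
    signMeas A (direction x) = signMeas A x := by
  by_cases hx : x = 0
  · simp [hx, direction_zero]
  ext i
  have h : A.mulVec (direction x).ofLp i = ‖x‖⁻¹ * A.mulVec x.ofLp i := by
    simp [direction, Matrix.mulVec_smul]
  rw [signMeas, signMeas, h, sign_mul, sign_pos (by positivity), one_mul]

lemma sq_direction_apply_of_mem_scaledBinary {k : ℕ} {x : EuclideanSpace ℝ (Fin n)}
    (hx : x ∈ scaledBinary n k) {i : Fin n} (hi : x i ≠ 0) :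
    direction x i ^ 2 = 1 / ((vecSupp x).card : ℝ) := by
  have hnorm : ‖x‖ ^ 2 = (vecSupp x).card * x i ^ 2 := by
    rw [EuclideanSpace.real_norm_sq_eq, ← nsmul_eq_mul, ← Finset.sum_const,
      ← Finset.sum_subset (Finset.subset_univ (vecSupp x))]
    · exact Finset.sum_congr rfl fun j hj => by rw [hx.2 j i (mem_vecSupp.1 hj) hi]
    · intro j _ hj
      rw [mem_vecSupp, not_not] at hj
      simp [hj]
  have hc : ((vecSupp x).card : ℝ) ≠ 0 := by
    exact_mod_cast Finset.card_ne_zero_of_mem (mem_vecSupp.2 hi)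
  rw [direction_apply, mul_pow, inv_pow, hnorm]
  field_simp

/-- Distinct directions of rescaled binary vectors are at distance at least `1 / √k`. -/
lemma one_div_sqrt_le_norm_direction_sub {k : ℕ} {x y : EuclideanSpace ℝ (Fin n)}
    (hx : x ∈ scaledBinary n k) (hy : y ∈ scaledBinary n k) (hxy : direction x ≠ direction y) :
    1 / √(k : ℝ) ≤ ‖direction x - direction y‖ := by
  have hinv {z : EuclideanSpace ℝ (Fin n)} (hz : z ∈ scaledBinary n k) {i : Fin n}
      (hi : z i ≠ 0) : 1 / (k : ℝ) ≤ direction z i ^ 2 := by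
    rw [sq_direction_apply_of_mem_scaledBinary hz hi]
    have : 0 < (vecSupp z).card := Finset.card_pos.2 ⟨i, mem_vecSupp.2 hi⟩
    have h2 := hz.1
    gcongr
  -- One coordinate witnesses the gap: where equal supports carry different entries, these are
  -- opposite; otherwise an index lies in just one support.
  have key : ∃ i, 1 / (k : ℝ) ≤ (direction x i - direction y i) ^ 2 := by
    by_cases hs : vecSupp x = vecSupp y
    · obtain ⟨i, hi⟩ : ∃ i, direction x i ≠ direction y i := by
        by_contra! h
        exact hxy (by ext i; exact h i)
      have hiff : x i ≠ 0 ↔ y i ≠ 0 := by rw [← mem_vecSupp, ← mem_vecSupp, hs]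
      have hxi : x i ≠ 0 := by
        intro h0
        have h1 : y i = 0 := by
          by_contra h; exact hiff.2 h h0
        exact hi (by simp [direction_apply, h0, h1])
      refine ⟨i, ?_⟩
      have h1 := sq_direction_apply_of_mem_scaledBinary hx hxi
      have h2 := sq_direction_apply_of_mem_scaledBinary hy (hiff.1 hxi)
      rw [← hs, ← h1, sq_eq_sq_iff_eq_or_eq_neg] at h2
      rcases h2 with h2 | h2
      · exact absurd h2.symm hi
      · rw [h2]
        nlinarith [hinv hx hxi, sq_nonneg (direction x i)]
    · obtain ⟨i, hi⟩ : ∃ i, ¬ (i ∈ vecSupp x ↔ i ∈ vecSupp y) := by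
        by_contra! h
        exact hs (Finset.ext h)
      refine ⟨i, ?_⟩
      rw [mem_vecSupp, mem_vecSupp] at hi
      by_cases hxi : x i = 0
      · have hyi : y i ≠ 0 := by tauto
        simpa [direction_apply x, hxi] using hinv hy hyi
      · have hyi : y i = 0 := by tauto
        simpa [direction_apply y, hyi] using hinv hx hxi
  obtain ⟨i, hi⟩ := key
  have h1 : |(direction x - direction y) i| ≤ ‖direction x - direction y‖ :=
    PiLp.norm_apply_le (direction x - direction y) i
  refine le_trans ?_ h1
  rw [← Real.sqrt_one, ← Real.sqrt_div zero_le_one]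
  exact Real.sqrt_le_iff.2 ⟨abs_nonneg _, by simpa [sq_abs] using hi⟩

lemma canExactlyRecover_of_injective {A : Matrix ι (Fin n) ℝ}
    {X : Set (EuclideanSpace ℝ (Fin n))}
    (h : ∀ x ∈ X, ∀ y ∈ X, signMeas A x = signMeas A y → direction x = direction y) :
    CanExactlyRecover A X := by
  classical
  refine ⟨fun s => if hs : ∃ x ∈ X, signMeas A x = s then direction hs.choose else 0,
    fun x hx => ?_⟩
  have hs : ∃ y ∈ X, signMeas A y = signMeas A x := ⟨x, hx, rfl⟩
  simp only [dif_pos hs]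
  exact h _ hs.choose_spec.1 _ hx hs.choose_spec.2

/-- Signals with equal measurements are both within `ε` of one decoded direction, hence the factor
2. -/
lemma CanApproxRecover.separatesAt {A : Matrix ι (Fin n) ℝ} {ε : ℝ}
    {X : Set (EuclideanSpace ℝ (Fin n))} (h : CanApproxRecover A ε X) :
    SeparatesAt A (2 * ε) X := by
  obtain ⟨f, hf⟩ := h
  intro x hx y hy hx0 hy0 hd heq
  have h1 := (hf x hx hx0).2
  have h2 := (hf y hy hy0).2
  rw [← heq, norm_sub_rev] at h2
  have h3 := norm_sub_le_norm_sub_add_norm_sub (direction x)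
    (direction (f (signMeas A x))) (direction y)
  linarith

/-- The decoder may return any nonzero consistent signal of `X`. -/
lemma SeparatesAt.canApproxRecover {A : Matrix ι (Fin n) ℝ} {ε : ℝ}
    {X : Set (EuclideanSpace ℝ (Fin n))} (h : SeparatesAt A ε X) :
    CanApproxRecover A ε X := by
  classical
  refine ⟨fun s => if hs : ∃ x ∈ X, x ≠ 0 ∧ signMeas A x = s then hs.choose else 0,
    fun x hx hx0 => ?_⟩
  have hs : ∃ y ∈ X, y ≠ 0 ∧ signMeas A y = signMeas A x := ⟨x, hx, hx0, rfl⟩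
  simp only [dif_pos hs]
  obtain ⟨h1, h2, h3⟩ := hs.choose_spec
  refine ⟨h2, ?_⟩
  by_contra! hlt
  exact h x hx _ h1 hx0 h2 hlt h3.symm

lemma SeparatesAt.mono {A : Matrix ι (Fin n) ℝ} {ε : ℝ} {X Y : Set (EuclideanSpace ℝ (Fin n))}
    (h : SeparatesAt A ε Y) (hXY : X ⊆ Y) : SeparatesAt A ε X :=
  fun x hx y hy => h x (hXY hx) y (hXY hy)

lemma sparseWithin_mono {k : ℕ} {U V : Finset (Fin n)} (h : U ⊆ V) :
    sparseWithin k U ⊆ sparseWithin k V :=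
  fun _ hx => ⟨hx.1, hx.2.trans h⟩

/-- If all measurements of `x` vanished, so would those of `-x`, whose direction is at distance 2.
This distinguishes nonzero signals from `0`, which separation ignores. -/
lemma SeparatesAt.signMeas_ne_zero {A : Matrix ι (Fin n) ℝ} {ε : ℝ} {k : ℕ} {U : Finset (Fin n)}
    (h : SeparatesAt A ε (sparseWithin k U)) (hε : ε < 2) {x : EuclideanSpace ℝ (Fin n)}
    (hx : x ∈ sparseWithin k U) (hx0 : x ≠ 0) : signMeas A x ≠ 0 := by
  intro h0
  refine h x hx (-x) (by simpa [sparseWithin, vecSupp_neg] using hx) hx0 (neg_ne_zero.2 hx0) ?_ ?_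
  · rw [direction_neg, sub_neg_eq_add, ← two_smul ℝ, norm_smul, norm_direction hx0]
    simpa using hε
  · rw [h0]
    ext i
    have h1 := congrFun h0 i
    simp only [signMeas, Pi.zero_apply, sign_eq_zero_iff] at h1
    simp [signMeas, Matrix.mulVec_neg, h1]

/-- The rows of a binary matrix that miss the support of a rescaled binary vector are the rows
with zero measurement. -/
lemma mulVec_eq_zero_iff_of_mem_scaledBinary {M : Matrix ι (Fin n) ℝ}
    (hM : ∀ i j, M i j = 0 ∨ M i j = 1) {k : ℕ} {x : EuclideanSpace ℝ (Fin n)}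
    (hx : x ∈ scaledBinary n k) (i : ι) :
    M.mulVec x.ofLp i = 0 ↔ ∀ j ∈ vecSupp x, M i j = 0 := by
  constructor
  · intro h j hj
    have hj' := mem_vecSupp.1 hj
    have hsum : M.mulVec x.ofLp i = (∑ l ∈ vecSupp x, M i l) * x j := by
      rw [Finset.sum_mul, Matrix.mulVec, dotProduct,
        ← Finset.sum_subset (Finset.subset_univ (vecSupp x))]
      · exact Finset.sum_congr rfl fun l hl => by rw [hx.2 l j (mem_vecSupp.1 hl) hj']
      · intro l _ hl
        rw [mem_vecSupp, not_not] at hl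
        simp [hl]
    -- A sum of nonnegative entries vanishes only termwise: no cancellation.
    rw [hsum, mul_eq_zero, or_iff_left hj',
      Finset.sum_eq_zero_iff_of_nonneg fun l _ => by rcases hM i l with h | h <;> simp [h]] at h
    exact h j hj
  · intro h
    rw [Matrix.mulVec, dotProduct]
    refine Finset.sum_eq_zero fun j _ => ?_
    by_cases hj : j ∈ vecSupp x
    · simp [h j hj]
    · rw [mem_vecSupp, not_not] at hj
      simp [hj]

/-- The sign measurements by a `(k, l)`-list disjunct matrix confine the supports to a common
set of at most `k + l` indices. -/
lemma IsListDisjunct.exists_common_support {M : Matrix ι (Fin n) ℝ} {k l : ℕ}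
    (hM : IsListDisjunct M k l) {x y : EuclideanSpace ℝ (Fin n)} (hx : x ∈ scaledBinary n k)
    (hy : y ∈ scaledBinary n k) (hxy : signMeas M x = signMeas M y) :
    ∃ U : Finset (Fin n), U.card ≤ k + l ∧ vecSupp x ⊆ U ∧ vecSupp y ⊆ U := by
  classical
  by_cases hk : n < k
  · exact ⟨Finset.univ, by simp; omega, Finset.subset_univ _, Finset.subset_univ _⟩
  -- The columns that no zero measurement rules out.
  let U : Finset (Fin n) := {j | ∀ i, M i j ≠ 0 → M.mulVec x.ofLp i ≠ 0}
  have hzero (i : ι) : M.mulVec x.ofLp i = 0 ↔ M.mulVec y.ofLp i = 0 := by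
    have := congrFun hxy i
    simp only [signMeas] at this
    rw [← sign_eq_zero_iff, this, sign_eq_zero_iff]
  refine ⟨U, ?_, fun j hj => ?_, fun j hj => ?_⟩
  · obtain ⟨S, hxS, -, hS⟩ := Finset.exists_subsuperset_card_eq (Finset.subset_univ (vecSupp x))
      hx.1 (by simpa using hk)
    -- Otherwise `l` columns `T` of `U` avoid `S`; a row meeting `T` and missing `S` measures zero,
    -- which rules out a column of `T`.
    by_contra! hU
    have hdiff : l ≤ (U \ S).card := by
      have := Finset.le_card_sdiff S U
      omega
    obtain ⟨T, hTU, hT⟩ := Finset.exists_subset_card_eq hdiff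
    obtain ⟨i, ⟨j, hj, hij⟩, hiS⟩ := hM.2 S T
      (Finset.disjoint_left.2 fun a ha haT => (Finset.mem_sdiff.1 (hTU haT)).2 ha) hS hT
    have hjU := (Finset.mem_sdiff.1 (hTU hj)).1
    simp only [U, Finset.mem_filter, Finset.mem_univ, true_and] at hjU
    exact hjU i hij ((mulVec_eq_zero_iff_of_mem_scaledBinary hM.1 hx i).2
      fun j hj => hiS j (hxS hj))
  · simp only [U, Finset.mem_filter, Finset.mem_univ, true_and]
    exact fun i hij h0 => hij ((mulVec_eq_zero_iff_of_mem_scaledBinary hM.1 hx i).1 h0 j hj)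
  · simp only [U, Finset.mem_filter, Finset.mem_univ, true_and]
    exact fun i hij h0 =>
      hij ((mulVec_eq_zero_iff_of_mem_scaledBinary hM.1 hy i).1 ((hzero i).1 h0) j hj)

lemma canExactlyRecover_fromRows {κ : Type} {k l : ℕ} {M₁ : Matrix ι (Fin n) ℝ}
    {M₂ : Matrix κ (Fin n) ℝ} {ε : ℝ} (hM : IsListDisjunct M₁ k l) (hε : ε < 1 / √(k : ℝ))
    (hsep : ∀ U : Finset (Fin n), U.card ≤ k + l → SeparatesAt M₂ ε (sparseWithin k U)) :
    CanExactlyRecover (Matrix.fromRows M₁ M₂) (scaledBinary n k) := by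
  refine canExactlyRecover_of_injective fun x hx y hy hxy => ?_
  have h₁ : signMeas M₁ x = signMeas M₁ y := by
    ext i
    simpa [signMeas, Matrix.fromRows_mulVec] using congrFun hxy (Sum.inl i)
  have h₂ : signMeas M₂ x = signMeas M₂ y := by
    ext i
    simpa [signMeas, Matrix.fromRows_mulVec] using congrFun hxy (Sum.inr i)
  obtain ⟨U, hU, hxU, hyU⟩ := hM.exists_common_support hx hy h₁
  have hxs : x ∈ sparseWithin k U := ⟨hx.1, hxU⟩
  have hys : y ∈ sparseWithin k U := ⟨hy.1, hyU⟩
  have hzero : signMeas M₂ 0 = 0 := by ext i; simp [signMeas]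
  have hε2 : ε < 2 := by
    refine hε.trans_le ?_
    -- For `k = 0` the bound `1 / √k` is `0` by convention.
    rcases Nat.eq_zero_or_pos k with rfl | hk
    · simp
    · have : 1 ≤ √(k : ℝ) := Real.one_le_sqrt.2 (by exact_mod_cast hk)
      rw [div_le_iff₀ (by linarith)]
      linarith
  by_cases hx0 : x = 0
  · by_cases hy0 : y = 0
    · rw [hx0, hy0]
    · exact absurd (by rw [← h₂, hx0, hzero]) ((hsep U hU).signMeas_ne_zero hε2 hys hy0)
  · by_cases hy0 : y = 0
    · exact absurd (by rw [h₂, hy0, hzero]) ((hsep U hU).signMeas_ne_zero hε2 hxs hx0)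
    · by_contra hne
      exact hsep U hU x hxs y hys hx0 hy0
        (hε.trans_le (one_div_sqrt_le_norm_direction_sub hx hy hne)) h₂

end Recovery

/-! ### Hitting many events with few points -/

section Covering

open MeasureTheory

/-- Greedy covering: if each of finitely many events has probability at least `δ`, then some `m`
points leave at most a fraction `(1 - δ) ^ m` of the events without a point. -/
lemma exists_points_card_unhit_le {Ω J : Type*} [MeasurableSpace Ω] (μ : Measure Ω)
    [IsProbabilityMeasure μ] (s : Finset J) (F : J → Set Ω)
    (hF : ∀ j ∈ s, MeasurableSet (F j)) {δ : ℝ} (hδ : ∀ j ∈ s, δ ≤ μ.real (F j)) (hδ1 : δ ≤ 1)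
    (m : ℕ) :
    ∃ (a : Fin m → Ω) (t : Finset J), t ⊆ s ∧ (∀ j ∈ s, j ∉ t → ∃ i, a i ∈ F j) ∧
      (t.card : ℝ) ≤ s.card * (1 - δ) ^ m := by
  classical
  induction m with
  | zero => exact ⟨Fin.elim0, s, subset_rfl, fun j hj hjt => absurd hj hjt, by simp⟩
  | succ m ih =>
    obtain ⟨a, t, hts, hit, hcard⟩ := ih
    have hint (j) (hj : j ∈ t) : Integrable ((F j).indicator (1 : Ω → ℝ)) μ :=
      (integrable_const (1 : ℝ)).indicator (hF j (hts hj))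
    -- Some point hits at least the average number of remaining events.
    obtain ⟨b, hb⟩ := exists_integral_le (μ := μ) (integrable_finsetSum t hint)
    rw [integral_finsetSum t hint] at hb
    have hlow : (t.card : ℝ) * δ ≤ ∑ j ∈ t, (F j).indicator (1 : Ω → ℝ) b := by
      refine le_trans ?_ hb
      rw [← nsmul_eq_mul, ← Finset.sum_const]
      refine Finset.sum_le_sum fun j hj => ?_
      rw [integral_indicator_one (hF j (hts hj))]
      exact hδ j (hts hj)
    have hcount : ∑ j ∈ t, (F j).indicator (1 : Ω → ℝ) b = ({j ∈ t | b ∈ F j}.card : ℝ) := by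
      simp [Set.indicator_apply]
    refine ⟨Fin.cons b a, {j ∈ t | b ∉ F j}, (Finset.filter_subset _ _).trans hts,
      fun j hj hjt => ?_, ?_⟩
    · by_cases hjt' : j ∈ t
      · exact ⟨0, by simpa [hjt'] using hjt⟩
      · obtain ⟨i, hi⟩ := hit j hj hjt'
        exact ⟨i.succ, by simpa using hi⟩
    · have hsplit : ({j ∈ t | b ∈ F j}.card : ℝ) + ({j ∈ t | b ∉ F j}.card : ℝ) = t.card := by
        exact_mod_cast Finset.card_filter_add_card_filter_not (s := t) (fun j => b ∈ F j)
      calc (({j ∈ t | b ∉ F j}.card : ℕ) : ℝ) ≤ t.card * (1 - δ) := by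
            rw [hcount] at hlow; linarith
        _ ≤ (s.card * (1 - δ) ^ m) * (1 - δ) :=
            mul_le_mul_of_nonneg_right hcard (by linarith)
        _ = s.card * (1 - δ) ^ (m + 1) := by ring

/-- If each of finitely many events has probability at least `δ`, then some `m` points hit all
of them, as soon as the number of events is less than `exp (δ * m)`. -/
lemma exists_points_hit_all {Ω J : Type*} [MeasurableSpace Ω] (μ : Measure Ω)
    [IsProbabilityMeasure μ] (s : Finset J) (F : J → Set Ω)
    (hF : ∀ j ∈ s, MeasurableSet (F j)) {δ : ℝ} (hδ : ∀ j ∈ s, δ ≤ μ.real (F j)) (hδ1 : δ ≤ 1)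
    {m : ℕ} (hm : (s.card : ℝ) < Real.exp (δ * m)) :
    ∃ a : Fin m → Ω, ∀ j ∈ s, ∃ i, a i ∈ F j := by
  obtain ⟨a, t, -, hit, hcard⟩ := exists_points_card_unhit_le μ s F hF hδ hδ1 m
  refine ⟨a, fun j hj => hit j hj ?_⟩
  have h1 : (1 - δ) ^ m ≤ Real.exp (-(δ * m)) := by
    rw [mul_comm, ← mul_neg, Real.exp_nat_mul]
    exact pow_le_pow_left₀ (by linarith) (Real.one_sub_le_exp_neg δ) m
  have h2 : (t.card : ℝ) < 1 := by
    calc (t.card : ℝ) ≤ s.card * (1 - δ) ^ m := hcard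
      _ ≤ s.card * Real.exp (-(δ * m)) := by gcongr
      _ < Real.exp (δ * m) * Real.exp (-(δ * m)) :=
          mul_lt_mul_of_pos_right hm (Real.exp_pos _)
      _ = 1 := by rw [← Real.exp_add, add_neg_cancel, Real.exp_zero]
  have h3 : t = ∅ := by
    rw [← Finset.card_eq_zero]
    have : t.card < 1 := by exact_mod_cast h2
    omega
  simp [h3]

end Covering

/-! ### Random list disjunct matrices -/

section ListDisjunct

open MeasureTheory

lemma log_choose_le {n k : ℕ} (hk : 1 ≤ k) (hkn : k ≤ n) :
    Real.log (n.choose k) ≤ k * (1 + Real.log (n / k)) := by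
  have hk0 : (0 : ℝ) < k := by exact_mod_cast hk
  have hn0 : (0 : ℝ) < n := by exact_mod_cast (hk.trans hkn)
  have h1 : (n.choose k : ℝ) ≤ (n / k : ℝ) ^ k * Real.exp k := by
    calc (n.choose k : ℝ) ≤ (n : ℝ) ^ k / k.factorial := Nat.choose_le_pow_div k n
      _ = (n / k : ℝ) ^ k * ((k : ℝ) ^ k / k.factorial) := by
        rw [div_pow]
        field_simp
      _ ≤ _ := by
        gcongr
        exact Real.pow_div_factorial_le_exp _ hk0.le k
  have h2 : (0 : ℝ) < n.choose k := by exact_mod_cast Nat.choose_pos hkn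
  calc Real.log (n.choose k) ≤ Real.log ((n / k : ℝ) ^ k * Real.exp k) := Real.log_le_log h2 h1
    _ = k * (1 + Real.log (n / k)) := by
      rw [Real.log_mul (by positivity) (by positivity), Real.log_pow, Real.log_exp]
      ring

/-- Independent uniform variables stay below a suitable threshold `r` with probability `1 / 2`
on any `k` coordinates. -/
lemma exists_unitInterval_threshold {k : ℕ} (hk : 1 ≤ k) :
    ∃ r : ℝ, r ^ k = 1 / 2 ∧ ∀ (n : ℕ) (S : Finset (Fin n)),
      (Measure.pi fun _ : Fin n => (volume : Measure unitInterval)).real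
        {a | ∀ j ∈ S, (a j : ℝ) ≤ r} = r ^ S.card := by
  classical
  obtain ⟨r, hr0, hr⟩ : ∃ r : ℝ, 0 ≤ r ∧ r ^ k = 1 / 2 :=
    ⟨(1 / 2 : ℝ) ^ ((k : ℝ)⁻¹), by positivity,
      Real.rpow_inv_natCast_pow (by norm_num) (by omega)⟩
  have hr1 : r ≤ 1 := by
    by_contra! h
    have := one_le_pow₀ h.le (n := k)
    norm_num [hr] at this
  refine ⟨r, hr, fun n S => ?_⟩
  have hset : {a : Fin n → unitInterval | ∀ j ∈ S, (a j : ℝ) ≤ r} =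
      Set.univ.pi fun j => if j ∈ S then Set.Iic ⟨r, hr0, hr1⟩ else Set.univ := by
    ext a
    simp only [Set.mem_ofPred_eq, Set.mem_univ_pi]
    refine forall_congr' fun j => ?_
    by_cases hj : j ∈ S
    · simp [hj, ← Subtype.coe_le_coe]
    · simp [hj]
  have hvol (j : Fin n) : (volume : Measure unitInterval)
      (if j ∈ S then Set.Iic ⟨r, hr0, hr1⟩ else Set.univ) =
      if j ∈ S then ENNReal.ofReal r else 1 := by
    split_ifs
    · simp
    · simp
  rw [hset, Measure.real, Measure.pi_pi]
  simp_rw [hvol]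
  rw [Finset.prod_ite_mem, Finset.univ_inter, Finset.prod_const, ENNReal.toReal_pow,
    ENNReal.toReal_ofReal hr0]

/-- An entry is `0` when its uniform variable is at most `r`. A row serves `(S, T)` when all of `S`,
but not all of `S ∪ T`, is low: probability `r ^ k - r ^ (2 * k) = 1 / 4`. -/
lemma exists_isListDisjunct_of_sq_choose_lt {n k m : ℕ} (hk : 1 ≤ k)
    (hm : (n.choose k : ℝ) ^ 2 < Real.exp (1 / 4 * m)) :
    ∃ M : Matrix (Fin m) (Fin n) ℝ, IsListDisjunct M k k := by
  classical
  obtain ⟨r, hr, hvol⟩ := exists_unitInterval_threshold hk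
  let low (S : Finset (Fin n)) : Set (Fin n → unitInterval) := {a | ∀ j ∈ S, (a j : ℝ) ≤ r}
  have hmeas (S : Finset (Fin n)) : MeasurableSet (low S) := by
    have : low S = ⋂ j ∈ S, {a | (a j : ℝ) ≤ r} := by ext; simp [low]
    rw [this]
    refine Finset.measurableSet_biInter S fun j _ => measurableSet_le ?_ measurable_const
    exact measurable_subtype_coe.comp (measurable_pi_apply j)
  let P : Finset (Finset (Fin n) × Finset (Fin n)) :=
    {p ∈ Finset.powersetCard k Finset.univ ×ˢ Finset.powersetCard k Finset.univ |
      Disjoint p.1 p.2}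
  have hP {p} (hp : p ∈ P) : p.1.card = k ∧ p.2.card = k ∧ Disjoint p.1 p.2 := by
    simp only [P, Finset.mem_filter, Finset.mem_product, Finset.mem_powersetCard] at hp
    exact ⟨hp.1.1.2, hp.1.2.2, hp.2⟩
  have hcard : (P.card : ℝ) ≤ (n.choose k : ℝ) ^ 2 := by
    have : P.card ≤ n.choose k ^ 2 := by
      refine (Finset.card_filter_le _ _).trans ?_
      simp [Finset.card_product, sq]
    exact_mod_cast this
  obtain ⟨a, ha⟩ := exists_points_hit_all
    (Measure.pi fun _ : Fin n => (volume : Measure unitInterval)) P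
    (fun p => low p.1 \ low (p.1 ∪ p.2)) (fun p _ => (hmeas _).diff (hmeas _)) (δ := 1 / 4)
    (fun p hp => by
      obtain ⟨h1, h2, h3⟩ := hP hp
      have hsub : low (p.1 ∪ p.2) ⊆ low p.1 :=
        fun a h j hj => h j (Finset.mem_union_left _ hj)
      rw [measureReal_sdiff hsub (hmeas _), hvol, hvol, Finset.card_union_of_disjoint h3, h1, h2,
        pow_add, hr]
      norm_num) (by norm_num) (hcard.trans_lt hm)
  refine ⟨fun i j => if (a i j : ℝ) ≤ r then 0 else 1, fun i j => ?_, fun S T hST hS hT => ?_⟩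
  · dsimp only
    split_ifs <;> simp
  · obtain ⟨i, hi, hi'⟩ := ha (S, T) (by simp [P, Finset.mem_powersetCard, hS, hT, hST])
    refine ⟨i, ?_, fun j hj => if_pos (hi j hj)⟩
    by_contra! h
    refine hi' fun j hj => ?_
    rcases Finset.mem_union.1 hj with hj | hj
    · exact hi j hj
    · by_contra hlt
      have := h j hj
      rw [if_neg hlt] at this
      exact one_ne_zero this

/-- There are `(k, k)`-list disjunct matrices with `O(k log (n / k))` rows. -/
lemma exists_isListDisjunct :
    ∃ C : ℝ, 1 ≤ C ∧ ∀ n k : ℕ, 1 ≤ k → k ≤ n →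
      ∃ (m : ℕ) (M : Matrix (Fin m) (Fin n) ℝ),
        (m : ℝ) ≤ C * (k * Real.log (n / k)) ∧ IsListDisjunct M k k := by
  have hlog2 := Real.log_two_gt_d9
  -- For `n ≥ 2k` the row count is at most `8k(1 + L) + 1 ≤ 8kL + 9k`, where `L = log (n / k) ≥ log
  -- 2 > 1 / 2`.
  refine ⟨27, by norm_num, fun n k hk hkn => ?_⟩
  have hk0 : (1 : ℝ) ≤ k := by exact_mod_cast hk
  -- No disjoint pair exists here, so zero rows suffice; this covers `log (n / k) = 0`.
  by_cases hn : n < 2 * k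
  · refine ⟨0, fun i => i.elim0, ?_, fun i => i.elim0, fun S T hST hS hT => ?_⟩
    · have : 0 ≤ Real.log (n / k) :=
        Real.log_nonneg ((one_le_div (by linarith)).2 (by exact_mod_cast hkn))
      push_cast
      positivity
    · have := Finset.card_le_univ (S ∪ T)
      rw [Finset.card_union_of_disjoint hST, hS, hT, Fintype.card_fin] at this
      omega
  · have hL : Real.log 2 ≤ Real.log (n / k) := by
      refine Real.log_le_log (by norm_num) ?_
      rw [le_div_iff₀ (by linarith)]
      exact_mod_cast (not_lt.1 hn)
    have hchoose := log_choose_le hk hkn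
    set L := Real.log (n / k) with hLdef
    have hpos : (0 : ℝ) < n.choose k := by exact_mod_cast Nat.choose_pos hkn
    have hx : 0 ≤ 8 * Real.log (n.choose k) :=
      mul_nonneg (by norm_num) (Real.log_natCast_nonneg _)
    obtain ⟨M, hM⟩ := exists_isListDisjunct_of_sq_choose_lt (n := n) hk
      (m := ⌊8 * Real.log (n.choose k)⌋₊ + 1) (by
        rw [← Real.log_lt_iff_lt_exp (by positivity), Real.log_pow]
        have := Nat.lt_floor_add_one (8 * Real.log (n.choose k))
        push_cast
        linarith)
    refine ⟨_, M, ?_, hM⟩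
    have hfl := Nat.floor_le hx
    push_cast
    have hkL : k * Real.log 2 ≤ k * L := by gcongr
    nlinarith

end ListDisjunct

/-! ### Gaussian hyperplanes and a sparse net -/

section GaussianRows

open MeasureTheory ProbabilityTheory
open scoped RealInnerProductSpace

/-- The standard Gaussian density at `2`, a lower bound of the density on `[-2, 2]`. -/
noncomputable def gaussianDensityTwo : ℝ := gaussianPDFReal 0 1 2

lemma gaussianDensityTwo_pos : 0 < gaussianDensityTwo :=
  gaussianPDFReal_pos 0 1 2 one_ne_zero

lemma sub_mul_le_gaussianReal_Icc {a b : ℝ} (ha : -2 ≤ a) (hab : a ≤ b) (hb : b ≤ 2) :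
    gaussianDensityTwo * (b - a) ≤ (gaussianReal 0 1).real (Set.Icc a b) := by
  rw [Measure.real, gaussianReal_apply_eq_integral 0 one_ne_zero, ENNReal.toReal_ofReal
    (setIntegral_nonneg measurableSet_Icc fun x _ => gaussianPDFReal_nonneg _ _ x)]
  have h := setIntegral_ge_of_const_le_real (μ := volume) (s := Set.Icc a b)
    (f := gaussianPDFReal 0 1) (c := gaussianDensityTwo) measurableSet_Icc
    (by simp) (fun x hx => ?_) (integrable_gaussianPDFReal 0 1).integrableOn
  · rwa [Real.volume_real_Icc_of_le hab] at h
  · simp only [gaussianDensityTwo, gaussianPDFReal, sub_zero, NNReal.coe_one, mul_one]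
    have : x ^ 2 ≤ 2 ^ 2 := sq_le_sq' (by linarith [hx.1]) (by linarith [hx.2])
    gcongr

lemma gaussianDensityTwo_le_one : gaussianDensityTwo ≤ 1 := by
  have h := sub_mul_le_gaussianReal_Icc (a := 0) (b := 1) (by norm_num) (by norm_num) (by norm_num)
  have h1 : (gaussianReal 0 1).real (Set.Icc 0 1) ≤ 1 := measureReal_le_one
  linarith

variable {E : Type*} [NormedAddCommGroup E] [InnerProductSpace ℝ E] [FiniteDimensional ℝ E]
  [MeasurableSpace E] [BorelSpace E]

lemma stdGaussian_map_inner (w : E) :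
    (stdGaussian E).map (fun a => ⟪w, a⟫) = (gaussianReal 0 1).map (fun g => ‖w‖ * g) := by
  have h := IsGaussian.map_eq_gaussianReal (μ := stdGaussian E) (innerSL ℝ w)
  rw [integral_strongDual_stdGaussian, variance_dual_stdGaussian, innerSL_apply_norm] at h
  rw [gaussianReal_map_const_mul, mul_zero, mul_one]
  refine Eq.trans h ?_
  congr 1
  exact Real.toNNReal_of_nonneg (sq_nonneg _)

lemma stdGaussian_real_inner_mem (w : E) {s : Set ℝ} (hs : MeasurableSet s) :
    (stdGaussian E).real {a | ⟪w, a⟫ ∈ s} = (gaussianReal 0 1).real {g | ‖w‖ * g ∈ s} := by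
  have h := congrArg (fun μ : Measure ℝ => μ.real s) (stdGaussian_map_inner w)
  rw [map_measureReal_apply (by fun_prop) hs, map_measureReal_apply (by fun_prop) hs] at h
  exact h

lemma integral_inner_sq_stdGaussian (w : E) :
    ∫ a, ⟪w, a⟫ ^ 2 ∂(stdGaussian E) = ‖w‖ ^ 2 := by
  have h := variance_dual_stdGaussian (innerSL ℝ w)
  rwa [variance_of_integral_eq_zero (by fun_prop) (integral_strongDual_stdGaussian _),
    innerSL_apply_norm] at h

/-- The two forms are jointly Gaussian with covariance `⟪u, v⟫`. -/
lemma indepFun_inner_stdGaussian {u v : E} (huv : ⟪u, v⟫ = 0) :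
    IndepFun (fun a => ⟪u, a⟫) (fun a => ⟪v, a⟫) (stdGaussian E) := by
  refine HasGaussianLaw.indepFun_of_covariance_eq_zero ?_ ?_
  · exact IsGaussian.hasGaussianLaw_id.map ((innerSL ℝ u).prod (innerSL ℝ v))
  · rw [← covarianceBilin_apply_eq_cov IsGaussian.memLp_two_id, covarianceBilin_stdGaussian]
    exact huv

/-- A Gaussian hyperplane separates two unit vectors at distance more than `ε`, with margin
`ε / 4`, with probability proportional to `ε`. -/
lemma le_stdGaussian_separating {x y : E} (hx : ‖x‖ = 1) (hy : ‖y‖ = 1) {ε : ℝ} (hε : 0 < ε)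
    (hxy : ε < ‖x - y‖) :
    gaussianDensityTwo ^ 2 * ε / 2 ≤
      (stdGaussian E).real {a | ε / 4 ≤ ⟪x, a⟫ ∧ ⟪y, a⟫ ≤ -(ε / 4)} := by
  have hc := gaussianDensityTwo_pos
  -- Equal norms make `u` and `v` orthogonal, so their forms are independent. If `|⟪u, a⟫| ≤ ‖v‖ /
  -- 2` and `⟪v, a⟫ ≥ ‖v‖`, then `x = u + v` and `y = u - v` get opposite signs with margin `‖v‖ / 2
  -- > ε / 4`.
  set u : E := (2⁻¹ : ℝ) • (x + y) with hu
  set v : E := (2⁻¹ : ℝ) • (x - y) with hv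
  have huv : ⟪u, v⟫ = 0 := by
    rw [hu, hv, real_inner_smul_left, real_inner_smul_right,
      (real_inner_add_sub_eq_zero_iff x y).2 (by rw [hx, hy])]
    simp
  have hx' : x = u + v := by rw [hu, hv]; module
  have hy' : y = u - v := by rw [hu, hv]; module
  have hvnorm : ‖v‖ = ‖x - y‖ / 2 := by
    rw [hv, norm_smul]
    norm_num
    ring
  have hu1 : ‖u‖ ≤ 1 := by
    rw [hu, norm_smul]
    have := norm_add_le x y
    norm_num
    linarith
  have hv1 : ‖v‖ ≤ 1 := by
    have := norm_sub_le x y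
    linarith
  have hv0 : 0 < ‖v‖ := by linarith
  have hA : gaussianDensityTwo * ‖v‖ ≤
      (stdGaussian E).real {a | ⟪u, a⟫ ∈ Set.Icc (-(‖v‖ / 2)) (‖v‖ / 2)} := by
    rw [stdGaussian_real_inner_mem u measurableSet_Icc]
    refine le_trans ?_ (measureReal_mono (s₁ := Set.Icc (-(‖v‖ / 2)) (‖v‖ / 2)) fun g hg => ?_)
    · refine le_trans (le_of_eq ?_)
        (sub_mul_le_gaussianReal_Icc (by linarith) (by linarith) (by linarith))
      ring
    · rw [Set.mem_Icc, ← abs_le] at hg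
      change _ ∈ Set.Icc _ _
      rw [Set.mem_Icc, ← abs_le, abs_mul, abs_norm]
      exact (mul_le_of_le_one_left (abs_nonneg g) hu1).trans hg
  have hB : gaussianDensityTwo ≤
      (stdGaussian E).real {a | ⟪v, a⟫ ∈ Set.Icc ‖v‖ (‖v‖ * 2)} := by
    rw [stdGaussian_real_inner_mem v measurableSet_Icc]
    refine le_trans ?_ (measureReal_mono (s₁ := Set.Icc 1 2) fun g hg => ?_)
    · refine le_trans (le_of_eq ?_)
        (sub_mul_le_gaussianReal_Icc (by norm_num) (by norm_num) le_rfl)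
      ring
    · exact ⟨le_mul_of_one_le_right hv0.le hg.1, mul_le_mul_of_nonneg_left hg.2 hv0.le⟩
  have hind := (indepFun_inner_stdGaussian huv).measure_inter_preimage_eq_mul
    (Set.Icc (-(‖v‖ / 2)) (‖v‖ / 2)) (Set.Icc ‖v‖ (‖v‖ * 2)) measurableSet_Icc measurableSet_Icc
  have hreal := congrArg ENNReal.toReal hind
  rw [ENNReal.toReal_mul] at hreal
  calc gaussianDensityTwo ^ 2 * ε / 2
      ≤ (gaussianDensityTwo * ‖v‖) * gaussianDensityTwo := by
        rw [hvnorm]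
        nlinarith [mul_pos hc hc]
    _ ≤ _ := mul_le_mul hA hB hc.le measureReal_nonneg
    _ = _ := hreal.symm
    _ ≤ _ := by
      refine measureReal_mono fun a ha => ?_
      obtain ⟨⟨h1, h2⟩, h3, -⟩ := ha
      simp only at h1 h2 h3
      refine ⟨?_, ?_⟩
      · rw [hx', inner_add_left]; linarith
      · rw [hy', inner_sub_left]; linarith

/-- Markov's inequality for `‖a‖ ^ 2`, whose mean is `n`. -/
lemma stdGaussian_norm_gt_le {n : ℕ} {R : ℝ} (hR : 0 < R) :
    (stdGaussian (EuclideanSpace ℝ (Fin n))).real {a | R < ‖a‖} ≤ n / R ^ 2 := by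
  have hcoord (i : Fin n) (a : EuclideanSpace ℝ (Fin n)) :
      a i = ⟪EuclideanSpace.single i (1 : ℝ), a⟫ := by
    simp [EuclideanSpace.inner_single_left]
  have hint (i : Fin n) : Integrable (fun a : EuclideanSpace ℝ (Fin n) => a i ^ 2)
      (stdGaussian (EuclideanSpace ℝ (Fin n))) := by
    have := (IsGaussian.memLp_dual (stdGaussian (EuclideanSpace ℝ (Fin n)))
      (EuclideanSpace.proj (𝕜 := ℝ) i) 2 (by simp)).integrable_sq
    simpa using this
  have hnorm (a : EuclideanSpace ℝ (Fin n)) : ‖a‖ ^ 2 = ∑ i, a i ^ 2 :=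
    EuclideanSpace.real_norm_sq_eq a
  have hmean : ∫ a, ‖a‖ ^ 2 ∂(stdGaussian (EuclideanSpace ℝ (Fin n))) = n := by
    simp_rw [hnorm]
    rw [integral_finsetSum _ fun i _ => hint i]
    simp_rw [hcoord, integral_inner_sq_stdGaussian]
    simp
  have hmarkov := mul_meas_ge_le_integral_of_nonneg
    (μ := stdGaussian (EuclideanSpace ℝ (Fin n))) (f := fun a => ‖a‖ ^ 2)
    (Filter.Eventually.of_forall fun a => sq_nonneg _)
    (by simp_rw [hnorm]; exact integrable_finsetSum _ fun i _ => hint i) (R ^ 2)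
  rw [hmean] at hmarkov
  rw [le_div_iff₀ (by positivity), mul_comm]
  refine le_trans (mul_le_mul_of_nonneg_left ?_ (sq_nonneg R)) hmarkov
  refine measureReal_mono fun a ha => ?_
  exact pow_le_pow_left₀ hR.le (le_of_lt ha) 2

/-- The sparse vectors in the unit ball have a net indexed by grids of coordinates. -/
lemma exists_sparse_grid_net {n k N : ℕ} (hkn : k ≤ n) (hN : 1 ≤ N) :
    ∃ ψ : (Fin k → Fin n × Fin (2 * N + 1)) → EuclideanSpace ℝ (Fin n),
      ∀ x : EuclideanSpace ℝ (Fin n), (vecSupp x).card ≤ k → ‖x‖ ≤ 1 →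
        ∃ t, ‖x - ψ t‖ ≤ k / N := by
  have hN0 : (0 : ℝ) < N := by exact_mod_cast hN
  -- Each `t` lists `k` positions with values on the grid of step `1 / N` in `[-1, 1]`. Rounding
  -- down costs at most `1 / N` per position.
  refine ⟨fun t => ∑ i, EuclideanSpace.single (t i).1 (((t i).2 : ℝ) / N - 1),
    fun x hx hx1 => ?_⟩
  obtain ⟨S, hxS, -, hS⟩ := Finset.exists_subsuperset_card_eq (Finset.subset_univ (vecSupp x))
    hx (by simpa using hkn)
  let e := S.equivFinOfCardEq hS
  have hcoord (i : Fin n) : |x i| ≤ 1 := (PiLp.norm_apply_le x i).trans hx1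
  have hnonneg (i : Fin n) : 0 ≤ (x i + 1) * N :=
    mul_nonneg (by linarith [(abs_le.1 (hcoord i)).1]) hN0.le
  have hlt (i : Fin n) : ⌊(x i + 1) * N⌋₊ < 2 * N + 1 := by
    rw [Nat.lt_succ_iff]
    refine Nat.floor_le_of_le ?_
    push_cast
    exact mul_le_mul_of_nonneg_right (by linarith [(abs_le.1 (hcoord i)).2]) hN0.le
  have hround (i : Fin n) : |x i - ((⌊(x i + 1) * N⌋₊ : ℝ) / N - 1)| ≤ 1 / N := by
    have h1 := Nat.floor_le (hnonneg i)
    have h2 := Nat.lt_floor_add_one ((x i + 1) * N)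
    have h3 : x i - ((⌊(x i + 1) * N⌋₊ : ℝ) / N - 1) =
        ((x i + 1) * N - ⌊(x i + 1) * N⌋₊) / N := by field_simp; ring
    rw [h3, abs_div, abs_of_pos hN0]
    gcongr
    rw [abs_le]
    constructor <;> linarith
  have hsum : x = ∑ i : Fin k, EuclideanSpace.single (e.symm i : Fin n) (x (e.symm i)) := by
    rw [e.symm.sum_comp fun j : S => EuclideanSpace.single (j : Fin n) (x j),
      Finset.sum_coe_sort S fun j => EuclideanSpace.single j (x j)]
    ext l
    simp only [WithLp.ofLp_sum, Finset.sum_apply, PiLp.single_apply,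
      Finset.sum_ite_eq]
    split_ifs with hl
    · rfl
    · by_contra h
      exact hl (hxS (mem_vecSupp.2 h))
  refine ⟨fun i => (e.symm i, ⟨⌊(x (e.symm i) + 1) * N⌋₊, hlt _⟩), ?_⟩
  nth_rewrite 1 [hsum]
  rw [← Finset.sum_sub_distrib]
  refine (norm_sum_le_of_le (f := fun i : Fin k => _) Finset.univ (n := fun _ => 1 / (N : ℝ))
    fun i _ => ?_).trans (by simp [div_eq_mul_inv])
  simp only
  rw [← PiLp.single_sub, PiLp.norm_single, Real.norm_eq_abs]
  exact hround _

end GaussianRows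

/-! ### From the net to separating matrices -/

section SeparatingMatrices

open MeasureTheory ProbabilityTheory
open scoped RealInnerProductSpace

lemma abs_inner_sub_inner_le {E : Type*} [NormedAddCommGroup E] [InnerProductSpace ℝ E]
    {x y p a : E} {η R : ℝ} (hx : ‖x - p‖ ≤ η) (hy : ‖y - p‖ ≤ η) (ha : ‖a‖ ≤ R) :
    |⟪x, a⟫ - ⟪y, a⟫| ≤ 2 * η * R := by
  have hη : 0 ≤ η := (norm_nonneg _).trans hx
  have hxy : ‖x - y‖ ≤ 2 * η := by
    have := norm_sub_le_norm_sub_add_norm_sub x p y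
    rw [norm_sub_rev p y] at this
    linarith
  rw [← inner_sub_left]
  refine (abs_real_inner_le_norm _ _).trans ?_
  gcongr

/-- A union bound over pairs of points of a finite net yields Gaussian rows that separate all
sparse signals whose directions are more than `ε` apart. -/
lemma exists_separatesAt_of_net {n k m : ℕ} {T : Type*} [Fintype T]
    {ψ : T → EuclideanSpace ℝ (Fin n)} {ε η R : ℝ} (hε : 0 < ε) (hε1 : ε ≤ 1) (hR : 0 < R)
    (hψ : ∀ x : EuclideanSpace ℝ (Fin n), (vecSupp x).card ≤ k → ‖x‖ ≤ 1 → ∃ t, ‖x - ψ t‖ ≤ η)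
    (hRn : n / R ^ 2 ≤ gaussianDensityTwo ^ 2 * ε / 4) (hηR : 2 * η * R < ε / 4)
    (hm : (Fintype.card T : ℝ) ^ 2 < Real.exp (gaussianDensityTwo ^ 2 * ε / 4 * m)) :
    ∃ M : Matrix (Fin m) (Fin n) ℝ, SeparatesAt M ε (sparseWithin k Finset.univ) := by
  classical
  -- Net points need not be unit vectors, so each relevant pair gets unit representatives `X`, `Y`,
  -- to which the Gaussian estimate applies.
  let J : Finset (T × T) :=
    {p | ∃ x y, ‖x‖ = 1 ∧ ‖y‖ = 1 ∧ ε < ‖x - y‖ ∧ ‖x - ψ p.1‖ ≤ η ∧ ‖y - ψ p.2‖ ≤ η}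
  have hJ : ∀ p ∈ J, ∃ x y, ‖x‖ = 1 ∧ ‖y‖ = 1 ∧ ε < ‖x - y‖ ∧ ‖x - ψ p.1‖ ≤ η ∧
      ‖y - ψ p.2‖ ≤ η := fun p hp => (Finset.mem_filter.1 hp).2
  have hcard : (J.card : ℝ) ≤ (Fintype.card T : ℝ) ^ 2 := by
    have : J.card ≤ Fintype.card T ^ 2 := by
      rw [sq, ← Fintype.card_prod]
      exact Finset.card_le_univ J
    exact_mod_cast this
  choose! X Y hX hY hXY hXψ hYψ using hJ
  have hmeas₁ (p) : MeasurableSet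
      {a | ε / 4 ≤ ⟪X p, a⟫ ∧ ⟪Y p, a⟫ ≤ -(ε / 4)} :=
    MeasurableSet.inter (s₁ := {a | ε / 4 ≤ ⟪X p, a⟫}) (s₂ := {a | ⟪Y p, a⟫ ≤ -(ε / 4)})
      (measurableSet_le measurable_const (by fun_prop))
      (measurableSet_le (by fun_prop) measurable_const)
  have hmeas₂ : MeasurableSet {a : EuclideanSpace ℝ (Fin n) | R < ‖a‖} :=
    measurableSet_lt measurable_const measurable_norm
  have hc := gaussianDensityTwo_pos
  have hc1 : gaussianDensityTwo ^ 2 ≤ 1 := pow_le_one₀ hc.le gaussianDensityTwo_le_one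
  have hprob (p) (hp : p ∈ J) : gaussianDensityTwo ^ 2 * ε / 4 ≤
      (stdGaussian (EuclideanSpace ℝ (Fin n))).real
        ({a | ε / 4 ≤ ⟪X p, a⟫ ∧ ⟪Y p, a⟫ ≤ -(ε / 4)} \ {a | R < ‖a‖}) := by
    have h1 := le_stdGaussian_separating (hX p hp) (hY p hp) hε (hXY p hp)
    have h2 := stdGaussian_norm_gt_le (n := n) hR
    have h3 := le_measureReal_sdiff (μ := stdGaussian (EuclideanSpace ℝ (Fin n)))
      (s₁ := {a | ε / 4 ≤ ⟪X p, a⟫ ∧ ⟪Y p, a⟫ ≤ -(ε / 4)}) (s₂ := {a | R < ‖a‖})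
    linarith
  obtain ⟨a, ha⟩ := exists_points_hit_all (stdGaussian (EuclideanSpace ℝ (Fin n))) J
    (fun p => {a | ε / 4 ≤ ⟪X p, a⟫ ∧ ⟪Y p, a⟫ ≤ -(ε / 4)} \ {a | R < ‖a‖})
    (fun p _ => (hmeas₁ p).diff hmeas₂) hprob (by nlinarith) (hcard.trans_lt hm)
  have hrow (i : Fin m) (z : EuclideanSpace ℝ (Fin n)) :
      (Matrix.of fun i j => a i j).mulVec z.ofLp i = ⟪z, a i⟫ := by
    simp [Matrix.mulVec, dotProduct, PiLp.inner_apply]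
  refine ⟨Matrix.of fun i j => a i j, fun x hx y hy hx0 hy0 hxy heq => ?_⟩
  rw [← signMeas_direction _ x, ← signMeas_direction _ y] at heq
  obtain ⟨s, hs⟩ := hψ (direction x) (by rw [vecSupp_direction]; exact hx.1)
    (norm_direction hx0).le
  obtain ⟨t, ht⟩ := hψ (direction y) (by rw [vecSupp_direction]; exact hy.1)
    (norm_direction hy0).le
  have hp : (s, t) ∈ J := Finset.mem_filter.2 ⟨Finset.mem_univ _, direction x, direction y,
    norm_direction hx0, norm_direction hy0, hxy, hs, ht⟩
  obtain ⟨i, hi⟩ := ha (s, t) hp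
  have hi₁ : ε / 4 ≤ ⟪X (s, t), a i⟫ := hi.1.1
  have hi₂ : ⟪Y (s, t), a i⟫ ≤ -(ε / 4) := hi.1.2
  have hnorm : ‖a i‖ ≤ R := not_lt.1 fun h => hi.2 h
  have hXs : ‖X (s, t) - ψ s‖ ≤ η := hXψ (s, t) hp
  have hYt : ‖Y (s, t) - ψ t‖ ≤ η := hYψ (s, t) hp
  -- Moving from the representative to the actual direction changes the product by less than the
  -- margin `ε / 4`.
  have hdx := abs_le.1 (abs_inner_sub_inner_le hs hXs hnorm)
  have hdy := abs_le.1 (abs_inner_sub_inner_le ht hYt hnorm)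
  have hsign := congrFun heq i
  rw [signMeas, signMeas, hrow, hrow, sign_pos (by linarith [hdx.1]),
    sign_neg (by linarith [hdy.2])] at hsign
  exact absurd hsign (by decide)

lemma exists_separatesAt_of_lt_exp {n k N m : ℕ} {ε R : ℝ} (hkn : k ≤ n) (hN : 1 ≤ N)
    (hε : 0 < ε) (hε1 : ε ≤ 1) (hR : 0 < R)
    (hRn : n / R ^ 2 ≤ gaussianDensityTwo ^ 2 * ε / 4)
    (hNR : 2 * ((k : ℝ) / N) * R < ε / 4)
    (hm : ((n : ℝ) * (2 * N + 1)) ^ (2 * k) < Real.exp (gaussianDensityTwo ^ 2 * ε / 4 * m)) :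
    ∃ M : Matrix (Fin m) (Fin n) ℝ, SeparatesAt M ε (sparseWithin k Finset.univ) := by
  obtain ⟨ψ, hψ⟩ := exists_sparse_grid_net hkn hN
  refine exists_separatesAt_of_net hε hε1 hR hψ hRn hNR ?_
  convert hm using 1
  simp only [Fintype.card_pi, Fintype.card_prod, Fintype.card_fin, Finset.prod_const,
    Finset.card_univ]
  push_cast
  rw [← pow_mul, mul_comm k 2]

lemma exists_le_log_separatesAt {c : ℝ} (hc0 : 0 < c) (hc1 : c < 1) :
    ∃ C : ℝ, 0 < C ∧ ∀ n k : ℕ, 2 ≤ n → 1 ≤ k → k ≤ n →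
      ∃ (m : ℕ) (M : Matrix (Fin m) (Fin n) ℝ), (m : ℝ) ≤ C * (k * √(k : ℝ) * Real.log n) ∧
        SeparatesAt M (c / √(k : ℝ)) (sparseWithin k Finset.univ) := by
  have hg := gaussianDensityTwo_pos
  set g := gaussianDensityTwo
  -- With `R = K * n` and `ε ≥ c / n`, this `K` makes the tail `n / R ^ 2` at most `g ^ 2 * ε / 4`.
  obtain ⟨K, hK⟩ := exists_nat_ge (max 1 (4 / (g ^ 2 * c)))
  have hK1 : (1 : ℝ) ≤ K := (le_max_left _ _).trans hK
  have hKg : 4 ≤ K * (g ^ 2 * c) :=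
    (div_le_iff₀ (by positivity)).1 ((le_max_right _ _).trans hK)
  -- With `N = L * n ^ 3`, this `L` keeps the rounding drift below `ε / 4`.
  obtain ⟨L, hL⟩ := exists_nat_gt (max 1 (8 * K / c))
  have hL1 : (1 : ℝ) ≤ L := (le_max_left _ _).trans hL.le
  have hLK : 8 * K < L * c := (div_lt_iff₀ hc0).1 ((le_max_right _ _).trans_lt hL)
  have hlog2 : 1 / 2 < Real.log 2 := by linarith [Real.log_two_gt_d9]
  have hlog2' : 0 < Real.log 2 := by linarith
  have hlogL : 0 ≤ Real.log (3 * L) := Real.log_nonneg (by linarith)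
  set D : ℝ := Real.log (3 * L) / Real.log 2 + 4 with hD
  have hD0 : 0 < D := by positivity
  -- The first term is the union bound; the `2` absorbs the `+ 1` after the floor.
  refine ⟨8 * D / (g ^ 2 * c) + 2, by positivity, fun n k hn hk hkn => ?_⟩
  have hn2 : (2 : ℝ) ≤ n := by exact_mod_cast hn
  have hk1 : (1 : ℝ) ≤ k := by exact_mod_cast hk
  have hkn' : (k : ℝ) ≤ n := by exact_mod_cast hkn
  have hsk1 : 1 ≤ √(k : ℝ) := Real.one_le_sqrt.2 hk1
  have hskn : √(k : ℝ) ≤ n := by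
    refine le_trans ?_ hkn'
    exact Real.sqrt_le_iff.2 ⟨by linarith, by nlinarith⟩
  have hsk0 : 0 < √(k : ℝ) := by linarith
  set ε := c / √(k : ℝ) with hε
  have hε0 : 0 < ε := by positivity
  have hε1 : ε ≤ 1 := (div_le_one hsk0).2 (by linarith)
  have hεn : c / n ≤ ε := div_le_div_of_nonneg_left hc0.le hsk0 hskn
  have hlogn : Real.log 2 ≤ Real.log n := Real.log_le_log (by norm_num) hn2
  have hlogn0 : 0 < Real.log n := by linarith
  have hlogN : Real.log ((n : ℝ) * (2 * (L * n ^ 3) + 1)) ≤ D * Real.log n := by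
    have h1 : (n : ℝ) * (2 * (L * n ^ 3) + 1) ≤ 3 * (L : ℝ) * n ^ 4 := by
      have : (1 : ℝ) ≤ L * n ^ 3 := one_le_mul_of_one_le_of_one_le hL1 (one_le_pow₀ (by linarith))
      calc (n : ℝ) * (2 * (L * n ^ 3) + 1) ≤ n * (3 * (L * n ^ 3)) := by gcongr; linarith
        _ = 3 * (L : ℝ) * n ^ 4 := by ring
    calc Real.log ((n : ℝ) * (2 * (L * n ^ 3) + 1)) ≤ Real.log (3 * (L : ℝ) * n ^ 4) :=
          Real.log_le_log (by positivity) h1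
      _ = Real.log (3 * L) + 4 * Real.log n := by
        rw [Real.log_mul (by positivity) (by positivity), Real.log_pow]
        norm_num
      _ ≤ Real.log (3 * L) / Real.log 2 * Real.log n + 4 * Real.log n := by
        gcongr
        rw [div_mul_eq_mul_div, le_div_iff₀ hlog2']
        gcongr
      _ = D * Real.log n := by rw [hD]; ring
  set B : ℝ := 2 * k * (D * Real.log n) / (g ^ 2 * ε / 4) with hB
  have hB0 : 0 ≤ B := by positivity
  have hBeq : B = 8 * D / (g ^ 2 * c) * (k * √(k : ℝ) * Real.log n) := by
    rw [hB, hε]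
    field_simp
    ring
  obtain ⟨M, hM⟩ := exists_separatesAt_of_lt_exp (N := L * n ^ 3) (m := ⌊B⌋₊ + 1) (ε := ε)
    (R := K * n) hkn
    (Nat.one_le_iff_ne_zero.2 (mul_ne_zero (by rintro rfl; norm_num at hL1)
      (pow_ne_zero _ (by omega)))) hε0 hε1 (by positivity)
    (by
      calc (n : ℝ) / (K * n) ^ 2 = 1 / ((K : ℝ) * K * n) := by field_simp
        _ ≤ 1 / ((K : ℝ) * n) := by
          gcongr
          exact le_mul_of_one_le_left (by linarith) hK1
        _ ≤ g ^ 2 * (c / n) / 4 := by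
          rw [div_le_iff₀ (by positivity)]
          field_simp
          linarith
        _ ≤ g ^ 2 * ε / 4 := by gcongr)
    (by
      push_cast
      calc 2 * ((k : ℝ) / (L * n ^ 3)) * (K * n) ≤ 2 * ((n : ℝ) / (L * n ^ 3)) * (K * n) := by
            gcongr
        _ = 2 * (K : ℝ) / (L * n) := by field_simp
        _ < c / n / 4 := by
          rw [div_lt_iff₀ (by positivity)]
          field_simp
          linarith
        _ ≤ ε / 4 := by gcongr)
    (by
      push_cast
      rw [← Real.log_lt_iff_lt_exp (by positivity), Real.log_pow]
      have h1 : B < (⌊B⌋₊ : ℝ) + 1 := Nat.lt_floor_add_one B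
      rw [hB, div_lt_iff₀ (by positivity), mul_comm _ (g ^ 2 * ε / 4)] at h1
      refine lt_of_le_of_lt ?_ h1
      push_cast
      gcongr)
  refine ⟨_, M, ?_, hM⟩
  have hfl : (⌊B⌋₊ : ℝ) ≤ B := Nat.floor_le hB0
  have hone : 1 ≤ 2 * (k * √(k : ℝ) * Real.log n) := by
    have h1 : 1 ≤ k * √(k : ℝ) := one_le_mul_of_one_le_of_one_le hk1 hsk1
    have h2 : 1 * Real.log n ≤ k * √(k : ℝ) * Real.log n := by gcongr
    linarith
  push_cast
  rw [add_mul, ← hBeq]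
  linarith

end SeparatingMatrices

/-! ### Row counts and assembly -/

lemma mul_sqrt_mul_log_le {n k : ℕ} (hn : 2 ≤ n) (hk : 1 ≤ k) (hkn : k ≤ n) :
    k * √(k : ℝ) * Real.log n ≤
      (k : ℝ) ^ (3 / 2 : ℝ) * Real.log ((n : ℝ) ^ (3 / 2 : ℝ) / √(k : ℝ)) := by
  have hpow (a : ℕ) (ha : 1 ≤ a) : (a : ℝ) ^ (3 / 2 : ℝ) = a * √(a : ℝ) := by
    have ha0 : (0 : ℝ) < a := by exact_mod_cast ha
    rw [Real.sqrt_eq_rpow, ← Real.rpow_one_add' ha0.le (by norm_num)]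
    norm_num
  have hk0 : (0 : ℝ) < k := by exact_mod_cast hk
  have hn0 : (0 : ℝ) < n := by exact_mod_cast (by omega : 0 < n)
  rw [hpow k hk, hpow n (by omega)]
  gcongr
  -- As `k ≤ n`, `n = n ^ (3 / 2) / √n ≤ n ^ (3 / 2) / √k`.
  rw [le_div_iff₀ (Real.sqrt_pos.2 hk0)]
  gcongr

theorem mainTheorem4 :
    -- distinct normalized rescaled binary vectors are at distance at least `1 / √k`
    (∀ (n k : ℕ), ∀ x ∈ scaledBinary n k, ∀ y ∈ scaledBinary n k, direction x ≠ direction y →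
      1 / √(k : ℝ) ≤ ‖direction x - direction y‖) ∧
    -- every two-part matrix recovers exactly, if the second part separates at `ε < 1 / √k`
    (∀ (n k l m₁ m₂ : ℕ) (M₁ : Matrix (Fin m₁) (Fin n) ℝ) (M₂ : Matrix (Fin m₂) (Fin n) ℝ) (ε : ℝ),
      IsListDisjunct M₁ k l → ε < 1 / √(k : ℝ) →
      (∀ U : Finset (Fin n), U.card ≤ k + l → SeparatesAt M₂ ε (sparseWithin k U)) →
      CanExactlyRecover (Matrix.fromRows M₁ M₂) (scaledBinary n k)) ∧
    -- the same, if the second part has arbitrary decoders with error `ε < 1 / (2 √k)`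
    (∀ (n k l m₁ m₂ : ℕ) (M₁ : Matrix (Fin m₁) (Fin n) ℝ) (M₂ : Matrix (Fin m₂) (Fin n) ℝ) (ε : ℝ),
      IsListDisjunct M₁ k l → ε < 1 / (2 * √(k : ℝ)) →
      (∀ U : Finset (Fin n), U.card ≤ k + l → CanApproxRecover M₂ ε (sparseWithin k U)) →
      CanExactlyRecover (Matrix.fromRows M₁ M₂) (scaledBinary n k)) ∧
    -- such matrices exist with the claimed numbers of rows
    (∀ c : ℝ, 0 < c → c < 1 → ∃ C : ℝ, 0 < C ∧ ∀ n k : ℕ, 2 ≤ n → 1 ≤ k → k ≤ n →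
      ∃ (l m₁ m₂ : ℕ) (M₁ : Matrix (Fin m₁) (Fin n) ℝ) (M₂ : Matrix (Fin m₂) (Fin n) ℝ),
        (l : ℝ) ≤ C * k ∧
        (m₁ : ℝ) ≤ C * (k * Real.log (n / k)) ∧
        (m₂ : ℝ) ≤ C * ((k : ℝ) ^ (3 / 2 : ℝ) * Real.log ((n : ℝ) ^ (3 / 2 : ℝ) / √(k : ℝ))) ∧
        IsListDisjunct M₁ k l ∧
        SeparatesAt M₂ (c / √(k : ℝ)) (sparseWithin k Finset.univ) ∧
        CanApproxRecover M₂ (c / √(k : ℝ)) (sparseWithin k Finset.univ) ∧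
        CanExactlyRecover (Matrix.fromRows M₁ M₂) (scaledBinary n k)) := by
  refine ⟨fun n k x hx y hy => one_div_sqrt_le_norm_direction_sub hx hy,
    fun n k l m₁ m₂ M₁ M₂ ε => canExactlyRecover_fromRows,
    fun n k l m₁ m₂ M₁ M₂ ε h₁ hε h₂ => ?_, fun c hc0 hc1 => ?_⟩
  · refine canExactlyRecover_fromRows (ε := 2 * ε) h₁ ?_ fun U hU => (h₂ U hU).separatesAt
    rw [mul_comm, ← div_div, lt_div_iff₀ two_pos] at hε
    linarith
  · obtain ⟨C₁, hC₁, h₁⟩ := exists_isListDisjunct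
    obtain ⟨C₂, hC₂, h₂⟩ := exists_le_log_separatesAt hc0 hc1
    refine ⟨max C₁ C₂, by positivity, fun n k hn hk hkn => ?_⟩
    obtain ⟨m₁, M₁, hm₁, hM₁⟩ := h₁ n k hk hkn
    obtain ⟨m₂, M₂, hm₂, hM₂⟩ := h₂ n k hn hk hkn
    have hk0 : (1 : ℝ) ≤ k := by exact_mod_cast hk
    have hlog : 0 ≤ Real.log (n / k) :=
      Real.log_nonneg ((one_le_div (by linarith)).2 (by exact_mod_cast hkn))
    -- Take `l = k`; the second block separates all sparse vectors, hence those within any `U`.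
    refine ⟨k, m₁, m₂, M₁, M₂, ?_, ?_, ?_, hM₁, hM₂, hM₂.canApproxRecover,
      canExactlyRecover_fromRows (ε := c / √(k : ℝ)) hM₁ ?_
        fun U _ => hM₂.mono (sparseWithin_mono U.subset_univ)⟩
    · exact le_mul_of_one_le_left (by linarith) (hC₁.trans (le_max_left _ _))
    · refine hm₁.trans ?_
      gcongr
      exact le_max_left _ _
    · refine hm₂.trans (mul_le_mul (le_max_right _ _) (mul_sqrt_mul_log_le hn hk hkn) ?_ ?_)
      · have := Real.log_natCast_nonneg n
        positivity
      · positivity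
    · gcongr
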